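/- Let $L=\{f_1,\dots,f_n\}$ be a language consisting of finitely many unary function symbols, and let $V$ be a generalized bijective variety of $L$-structures: $V$ is the class of all $L$-structures satisfying some set of identities $(\forall\bar x)\,t(\bar x)=t'(\bar x)$, and the theory of $V$ (the set of sentences true in all members of $V$) entails, for each $i$, that $f_i$ is injective and surjective. Let $T$ be any completion of the theory of $V$. Then $T$ is superstable; indeed $T$ is $\kappa$-stable for every $\kappa\ge 2^{\aleph_0}$. Moreover, if $X$ is any set of elements of a model of $T$ and $\kappa=|X|$, then there are at most $\kappa+2^{\aleph_0}$ complete $1$-types over $X$. Here, for an infinite cardinal $\kappa$, a complete theory $T$ is $\kappa$-stable if for every set $A$ of cardinality $\kappa$ in a model of $T$ and every $k\ge 1$, the set of complete $k$-types over $A$ has cardinality $\kappa$; and $T$ is superstable if it is $\kappa$-stable for all sufficiently large $\kappa$. -/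

import Mathlib

universe w u

namespace GenBij

open Cardinal FirstOrder FirstOrder.Language

/-- The function symbols `f_0, …, f_{n-1}`, all of them unary. -/
inductive UnarySymbol (n : ℕ) : ℕ → Type
  | symb (i : Fin n) : UnarySymbol n 1

/-- The first-order language whose only symbols are the unary function symbols
`f_0, …, f_{n-1}`. -/
abbrev unaryLanguage (n : ℕ) : FirstOrder.Language.{0, 0} where
  Functions := UnarySymbol n
  Relations := fun _ => Empty

/-- The function symbol `f_i`. -/
def symb {n : ℕ} (i : Fin n) : (unaryLanguage n).Functions 1 := UnarySymbol.symb i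

section Varieties

variable {L : FirstOrder.Language.{0, 0}}

/-- Classes of (nonempty) `L`-structures. -/
abbrev StructureClass (L : FirstOrder.Language.{0, 0}) : Type (w + 1) :=
  Set (Theory.ModelType.{0, 0, w} (∅ : L.Theory))

/-- A sentence of the form `∀ x₁ … x_m, t(x₁, …, x_m) = t'(x₁, …, x_m)`. -/
def IsIdentity (φ : L.Sentence) : Prop :=
  ∃ (m : ℕ) (t t' : L.Term (Empty ⊕ Fin m)),
    φ = (t.bdEqual t').alls

/-- An algebraic variety, as an equational class: the class of all structures satisfying
some set `E` of identities. -/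
def IsVariety (V : StructureClass.{w} L) : Prop :=
  ∃ E : L.Theory, (∀ φ ∈ E, IsIdentity φ) ∧ ∀ M, M ∈ V ↔ M ⊨ E

/-- The first-order theory of a class of structures: all sentences true in all its members. -/
def theoryOf (V : StructureClass.{w} L) : L.Theory :=
  {φ | ∀ M ∈ V, M ⊨ φ}

/-- `T` is a completion of `T₀`: a complete (in particular satisfiable) theory that entails
every sentence of `T₀`. -/
def IsCompletion (T₀ T : L.Theory) : Prop :=
  T.IsComplete ∧ ∀ φ ∈ T₀, T ⊨ᵇ φ

end Varieties

section Bijective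

variable {n : ℕ}

/-- The sentence `∀ x y, f_i(x) = f_i(y) → x = y`. -/
def injSentence (i : Fin n) : (unaryLanguage n).Sentence :=
  ∀' ∀' (((symb i).apply₁ (&0) =' (symb i).apply₁ (&1)) ⟹ ((&0) =' (&1)))

/-- The sentence `∀ y, ∃ x, f_i(x) = y`. -/
def surjSentence (i : Fin n) : (unaryLanguage n).Sentence :=
  ∀' ∃' ((symb i).apply₁ (&1) =' (&0))

/-- A generalized bijective variety: a variety of structures with `n` unary functions whose
theory entails that each of the functions is injective and surjective. -/
structure IsGeneralizedBijective (V : StructureClass.{w} (unaryLanguage n)) : Prop where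
  isVariety : IsVariety V
  injective : ∀ i : Fin n, theoryOf V ⊨ᵇ injSentence i
  surjective : ∀ i : Fin n, theoryOf V ⊨ᵇ surjSentence i

end Bijective

section Stability

variable {L : FirstOrder.Language.{0, 0}}

/-- The space `S_k^M(A)` of complete `k`-types over a set `A` of parameters from `M`: the
complete types in `k` variables over the theory of `M` with constants naming the elements
of `A`. -/
abbrev TypesOver (L : FirstOrder.Language.{0, 0}) {M : Type u} [L.Structure M] (A : Set M) (k : ℕ) :
    Type u :=
  (L[[A]].completeTheory M).CompleteType (Fin k)

/-- `κ`-stability, for an infinite cardinal `κ`: over every set of `κ` parameters in a model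
of `T` there are exactly `κ` complete `k`-types, for every `k ≥ 1`. -/
def IsStableIn (T : L.Theory) (κ : Cardinal.{u}) : Prop :=
  ∀ (M : Type u) [L.Structure M] [Nonempty M] [M ⊨ T] (A : Set M), #A = κ →
    ∀ k : ℕ, 1 ≤ k → #(TypesOver L A k) = κ

/-- Superstability: `κ`-stability for all sufficiently large (infinite) cardinals `κ`. -/
def IsSuperstable (T : L.Theory) : Prop :=
  ∃ κ₀ : Cardinal.{u}, ∀ κ : Cardinal.{u}, ℵ₀ ≤ κ → κ₀ ≤ κ → IsStableIn T κ

end Stability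

end GenBij

/-! Of the variety only bijectivity of the functions matters. It turns a model into a set acted on
by the free group `G` on the `n` function symbols, and `G` is countable. Automorphisms over `X` are
then the `G`-equivariant permutations fixing `X` pointwise. Exchanging isomorphic orbits shows that
a tuple is determined up to such automorphisms by the relations `g • a i = a j` and by the points at
which the orbits of its entries meet `X` (`exists_equivariant_perm_of_tupleRelations_eq`). In a
single model realizing all `k`-types over `X`, conjugate tuples have equal types, so there are at
most as many types as relation patterns, hence at most `#X + 2 ^ ℵ₀`. Conversely the formulas `x =
a` give at least `#X` types. -/

open Cardinal FirstOrder FirstOrder.Language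

/-! ### Equivariant permutations of a set with a group action -/

namespace MulAction

variable {G X : Type*} [Group G] [MulAction G X]

open scoped Classical in
/-- The map sending `g • a` to `g • b` and fixing everything outside the orbit of `a`. -/
noncomputable def orbitTransfer (G : Type*) {X : Type*} [Group G] [MulAction G X]
    (a b x : X) : X :=
  if h : ∃ g : G, g • a = x then h.choose • b else x

/-- Two group elements taking `a` to the same point differ by a stabilizer element of `a`, which
fixes `b` as well, so the choice made in the definition is harmless. -/
theorem orbitTransfer_smul {a b : X} (h : ∀ g : G, g • a = a ↔ g • b = b) (g : G) :
    orbitTransfer G a b (g • a) = g • b := by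
  have hex : ∃ g' : G, g' • a = g • a := ⟨g, rfl⟩
  rw [orbitTransfer, dif_pos hex]
  have h1 : (g⁻¹ * hex.choose) • a = a := by
    rw [mul_smul, hex.choose_spec, inv_smul_smul]
  rw [h, mul_smul, inv_smul_eq_iff] at h1
  exact h1

theorem orbitTransfer_of_not_exists {a b x : X} (h : ¬ ∃ g : G, g • a = x) :
    orbitTransfer G a b x = x := dif_neg h

open scoped Classical in
/-- The map exchanging the orbits of `a` and `b`, sending `g • a` to `g • b`. -/
noncomputable def orbitSwap (G : Type*) {X : Type*} [Group G] [MulAction G X] (a b x : X) : X :=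
  if ∃ g : G, g • a = x then orbitTransfer G a b x else orbitTransfer G b a x

theorem orbitSwap_smul {a b : X} (h : ∀ g : G, g • a = a ↔ g • b = b) (g : G) :
    orbitSwap G a b (g • a) = g • b := by
  rw [orbitSwap, if_pos ⟨g, rfl⟩, orbitTransfer_smul h]

theorem orbitSwap_smul_right {a b : X} (h : ∀ g : G, g • a = a ↔ g • b = b) (g : G)
    (hab : ¬ ∃ k : G, k • a = b) : orbitSwap G a b (g • b) = g • a := by
  have h1 : ¬ ∃ k : G, k • a = g • b := by
    rintro ⟨k, hk⟩
    exact hab ⟨g⁻¹ * k, by rw [mul_smul, hk, inv_smul_smul]⟩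
  rw [orbitSwap, if_neg h1, orbitTransfer_smul fun k => (h k).symm]

theorem orbitSwap_of_not_exists {a b x : X} (ha : ¬ ∃ g : G, g • a = x)
    (hb : ¬ ∃ g : G, g • b = x) : orbitSwap G a b x = x := by
  rw [orbitSwap, if_neg ha, orbitTransfer_of_not_exists hb]

/-- The inverse has `a` and `b` interchanged: when they share an orbit, the map is `g • a ↦ g • b`
on that orbit and need not be an involution. -/
theorem orbitSwap_orbitSwap {a b : X} (h : ∀ g : G, g • a = a ↔ g • b = b) (x : X) :
    orbitSwap G b a (orbitSwap G a b x) = x := by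
  by_cases ha : ∃ g : G, g • a = x
  · obtain ⟨g, rfl⟩ := ha
    rw [orbitSwap_smul h, orbitSwap_smul fun k => (h k).symm]
  · by_cases hb : ∃ g : G, g • b = x
    · obtain ⟨g, rfl⟩ := hb
      have hab : ¬ ∃ k : G, k • a = b := by
        rintro ⟨k, hk⟩
        exact ha ⟨g * k, by rw [mul_smul, hk]⟩
      have hba : ¬ ∃ k : G, k • b = a := by
        rintro ⟨k, hk⟩
        exact hab ⟨k⁻¹, by rw [← hk, inv_smul_smul]⟩
      rw [orbitSwap_smul_right h g hab, orbitSwap_smul_right (fun k => (h k).symm) g hba]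
    · rw [orbitSwap_of_not_exists ha hb, orbitSwap_of_not_exists hb ha]

theorem orbitSwap_equivariant {a b : X} (h : ∀ g : G, g • a = a ↔ g • b = b) (k : G) (x : X) :
    orbitSwap G a b (k • x) = k • orbitSwap G a b x := by
  have key (c : X) : (∃ g : G, g • c = k • x) ↔ ∃ g : G, g • c = x := by
    constructor
    · rintro ⟨g, hg⟩
      exact ⟨k⁻¹ * g, by rw [mul_smul, hg, inv_smul_smul]⟩
    · rintro ⟨g, rfl⟩
      exact ⟨k * g, mul_smul _ _ _⟩
  by_cases ha : ∃ g : G, g • a = x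
  · obtain ⟨g, rfl⟩ := ha
    rw [← mul_smul, orbitSwap_smul h, orbitSwap_smul h, mul_smul]
  · by_cases hb : ∃ g : G, g • b = x
    · obtain ⟨g, rfl⟩ := hb
      have hab : ¬ ∃ k : G, k • a = b := by
        rintro ⟨k, hk⟩
        exact ha ⟨g * k, by rw [mul_smul, hk]⟩
      rw [← mul_smul, orbitSwap_smul_right h _ hab, orbitSwap_smul_right h _ hab, mul_smul]
    · rw [orbitSwap_of_not_exists ha hb, orbitSwap_of_not_exists (by rwa [key]) (by rwa [key])]

/-- Two points with the same stabilizer and the same relations to a set `B` are conjugate under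
an equivariant permutation fixing `B`. -/
theorem exists_equivariant_perm (B : Set X) {a b : X} (h : ∀ g : G, g • a = a ↔ g • b = b)
    (hB : ∀ g : G, ∀ β ∈ B, g • a = β ↔ g • b = β) :
    ∃ σ : Equiv.Perm X, (∀ (g : G) x, σ (g • x) = g • σ x) ∧ (∀ β ∈ B, σ β = β) ∧ σ a = b := by
  -- If the orbit of `a` meets `B`, cancelling `g` forces `a = b`. Otherwise both orbits miss `B`,
  -- and swapping them leaves `B` fixed.
  by_cases hex : ∃ g : G, ∃ β ∈ B, g • a = β
  · obtain ⟨g, β, hβ, hg⟩ := hex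
    have hg' := (hB g β hβ).1 hg
    exact ⟨1, fun _ _ => rfl, fun _ _ => rfl, smul_left_cancel g (hg.trans hg'.symm)⟩
  · refine ⟨⟨orbitSwap G a b, orbitSwap G b a, orbitSwap_orbitSwap h,
      orbitSwap_orbitSwap fun k => (h k).symm⟩, orbitSwap_equivariant h, fun β hβ => ?_, ?_⟩
    · refine orbitSwap_of_not_exists (fun ⟨g, hg⟩ => hex ⟨g, β, hβ, hg⟩)
        (fun ⟨g, hg⟩ => hex ⟨g, β, hβ, (hB g β hβ).2 hg⟩)
    · simpa using orbitSwap_smul h 1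

/-- Two finite tuples with the same internal relations and the same relations to a set `B` are
conjugate under an equivariant permutation fixing `B`. -/
theorem exists_equivariant_perm_tuple (B : Set X) {k : ℕ} (a b : Fin k → X)
    (h : ∀ i j, ∀ g : G, g • a i = a j ↔ g • b i = b j)
    (hB : ∀ i, ∀ g : G, ∀ β ∈ B, g • a i = β ↔ g • b i = β) :
    ∃ σ : Equiv.Perm X, (∀ (g : G) x, σ (g • x) = g • σ x) ∧ (∀ β ∈ B, σ β = β) ∧
      ∀ i, σ (a i) = b i := by
  induction k with
  | zero => exact ⟨1, fun _ _ => rfl, fun _ _ => rfl, fun i => i.elim0⟩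
  | succ k ih =>
    obtain ⟨σ, hσ, hσB, hσa⟩ := ih (fun i => a i.castSucc) (fun i => b i.castSucc)
      (fun i j => h _ _) (fun i => hB _)
    have key (x : X) (g : G) : g • σ (a (Fin.last k)) = σ x ↔ g • a (Fin.last k) = x := by
      rw [← hσ, σ.apply_eq_iff_eq]
    -- Adding the entries already matched to the fixed set keeps the next swap from disturbing them.
    obtain ⟨τ, hτ, hτB, hτa⟩ := exists_equivariant_perm (G := G)
      (B ∪ Set.range fun i : Fin k => b i.castSucc)
      (a := σ (a (Fin.last k))) (b := b (Fin.last k))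
      (fun g => by rw [key, h]) (by
        rintro g β (hβ | ⟨i, rfl⟩)
        · rw [← hB _ g β hβ, ← key, hσB β hβ]
        · dsimp only
          rw [← h, ← key, hσa])
    refine ⟨τ * σ, fun g x => ?_, fun β hβ => ?_, fun i => ?_⟩
    · simp [hσ, hτ]
    · simp [hσB β hβ, hτB β (.inl hβ)]
    · refine Fin.lastCases ?_ (fun j => ?_) i
      · simpa using hτa
      · simpa [hσa] using hτB _ (.inr ⟨j, rfl⟩)

open scoped Classical in
/-- The relations of a tuple to a family of points `c` and among its own entries. -/
noncomputable def tupleRelations (G : Type*) {X A : Type*} [Group G] [MulAction G X] (c : A → X)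
    {k : ℕ} (a : Fin k → X) : (Fin k → Option (G × A)) × (Fin k → Fin k → Set G) :=
  (fun i => if h : ∃ p : G × A, p.1 • a i = c p.2 then some h.choose else none,
    fun i j => {g | g • a i = a j})

/-- One recorded witness per entry is enough: a common `(g, α)` gives `g • a i = c α = g • b i`, so
`a i = b i` and all other relations to `c` agree. -/
theorem exists_equivariant_perm_of_tupleRelations_eq {A : Type*} (c : A → X) {k : ℕ}
    {a b : Fin k → X} (h : tupleRelations G c a = tupleRelations G c b) :
    ∃ σ : Equiv.Perm X, (∀ (g : G) x, σ (g • x) = g • σ x) ∧ (∀ α, σ (c α) = c α) ∧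
      ∀ i, σ (a i) = b i := by
  have half {a b : Fin k → X} (h : tupleRelations G c a = tupleRelations G c b) (i : Fin k)
      (hex : ∃ p : G × A, p.1 • a i = c p.2) : a i = b i := by
    have h1 := congrFun (congrArg Prod.fst h) i
    simp only [tupleRelations] at h1
    rw [dif_pos hex] at h1
    split_ifs at h1 with hb
    have h2 := Option.some.inj h1
    have ha' := hex.choose_spec
    have hb' := hb.choose_spec
    rw [← h2] at hb'
    exact smul_left_cancel _ (ha'.trans hb'.symm)
  obtain ⟨σ, h1, h2, h3⟩ := exists_equivariant_perm_tuple (G := G) (Set.range c) a b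
    (fun i j g => by
      have := congrFun (congrFun (congrArg Prod.snd h) i) j
      exact Set.ext_iff.1 this g)
    (by
      rintro i g _ ⟨α, rfl⟩
      constructor
      · intro hg
        rwa [← half h i ⟨(g, α), hg⟩]
      · intro hg
        rwa [← half h.symm i ⟨(g, α), hg⟩])
  exact ⟨σ, h1, fun α => h2 _ ⟨α, rfl⟩, h3⟩

end MulAction

/-! ### Realizing all types of a complete theory in one model -/

namespace FirstOrder.Language.Theory

universe u₁ v₁ w₁

variable {L : FirstOrder.Language.{u₁, v₁}}

/-- Over a complete theory, any finitely many formulas of each type are realized in every model. -/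
theorem CompleteType.exists_realize_finite {T : L.Theory} (hT : T.IsComplete) {α : Type w₁}
    [Finite α] (M : Type*) [L.Structure M] [Nonempty M] [M ⊨ T] (p : T.CompleteType α)
    (S : Finset (L.Formula α)) (hS : ∀ φ ∈ S, Formula.equivSentence φ ∈ p) :
    ∃ v : α → M, ∀ φ ∈ S, φ.Realize v := by
  obtain ⟨N, v, rfl⟩ := T.exists_modelType_is_realized_in p
  let ψ : L.Formula α := Formula.iInf (fun φ : S => φ.1)
  let χ : L.Sentence := (ψ.relabel (Sum.inr : α → Empty ⊕ α)).iExs α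
  have h1 : N ⊨ χ := by
    simp only [χ, Sentence.Realize, Formula.realize_iExs, Formula.realize_relabel,
      Sum.elim_comp_inr, ψ, Formula.realize_iInf, Subtype.forall]
    exact ⟨v, fun φ hφ => formula_mem_typeOf.1 (hS φ hφ)⟩
  -- Completeness carries the existential sentence `χ` from `N` to `M`.
  rw [hT.realize_sentence_iff, ← hT.realize_sentence_iff χ M] at h1
  simpa only [χ, Sentence.Realize, Formula.realize_iExs, Formula.realize_relabel,
      Sum.elim_comp_inr, ψ, Formula.realize_iInf, Subtype.forall] using h1

/-- A complete theory has a model realizing all complete types in finitely many variables. -/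
theorem IsComplete.exists_model_forall_realized {T : L.Theory} (hT : T.IsComplete) (α : Type w₁)
    [Finite α] : ∃ N : ModelType.{u₁, v₁, max u₁ v₁ w₁} T,
      ∀ p : T.CompleteType α, ∃ v : α → N, T.typeOf v = p := by
  -- Each type gets its own tuple of new constants, which `Γ` requires to realize it.
  let C := T.CompleteType α × α
  let S : Set (T.CompleteType α × L.Formula α) := {x | Formula.equivSentence x.2 ∈ x.1}
  let f : T.CompleteType α × L.Formula α → L[[C]].Sentence :=
    fun x => Formula.equivSentence (x.2.relabel (fun i => ((x.1, i) : C)))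
  let Γ : L[[C]].Theory := (L.lhomWithConstants C).onTheory T ∪ f '' S
  have hΓ : Γ.IsSatisfiable := by
    classical
    obtain ⟨M⟩ := hT.1
    rw [isSatisfiable_iff_isFinitelySatisfiable]
    intro T0 hT0
    obtain ⟨S0, hS0, hS0'⟩ := Finset.subset_set_image_iff.1
      (show ((T0.filter (· ∈ f '' S) : Finset _) : Set _) ⊆ f '' S by
        intro x hx
        exact (Finset.mem_filter.1 hx).2)
    -- Distinct types use disjoint constants, so a finite part of `Γ` can be satisfied one type at a
    -- time in the same `M`.
    have hv (p : T.CompleteType α) : ∃ v : α → M, ∀ φ, (p, φ) ∈ S0 → φ.Realize v := by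
      obtain ⟨v, hv⟩ := p.exists_realize_finite hT M ((S0.filter (·.1 = p)).image Prod.snd) (by
        simp only [Finset.mem_image, Finset.mem_filter]
        rintro φ ⟨⟨q, φ⟩, ⟨h1, rfl⟩, rfl⟩
        exact hS0 h1)
      refine ⟨v, fun φ hφ => hv φ ?_⟩
      simp only [Finset.mem_image, Finset.mem_filter]
      exact ⟨(p, φ), ⟨hφ, rfl⟩, rfl⟩
    choose v hv using hv
    let : (constantsOn C).Structure M := constantsOn.structure fun c => v c.1 c.2
    have hmodel : M ⊨ (T0 : L[[C]].Theory) := by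
      refine ⟨fun φ hφ => ?_⟩
      rcases hT0 hφ with h | h
      · have : M ⊨ (L.lhomWithConstants C).onTheory T := (LHom.onTheory_model _ T).2 inferInstance
        exact this.realize_of_mem _ h
      · have h1 : φ ∈ S0.image f := by
          rw [hS0']
          exact Finset.mem_filter.2 ⟨hφ, h⟩
        obtain ⟨⟨p, ψ⟩, hp, rfl⟩ := Finset.mem_image.1 h1
        rw [Formula.realize_equivSentence, Formula.realize_relabel]
        exact hv p ψ hp
    exact Model.isSatisfiable M
  obtain ⟨N⟩ := hΓ
  have hN : N ⊨ (L.lhomWithConstants C).onTheory T := Model.mono N.is_model Set.subset_union_left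
  let := (L.lhomWithConstants C).reduct N
  have : (L.lhomWithConstants C).IsExpansionOn N := LHom.isExpansionOn_reduct _ _
  have : N ⊨ T := (LHom.onTheory_model (L.lhomWithConstants C) T).1 hN
  refine ⟨ModelType.of T N, fun p => ⟨fun i => (L.con ((p, i) : C) : N), ?_⟩⟩
  have hreal (φ : L.Formula α) (hφ : Formula.equivSentence φ ∈ p) :
      φ.Realize fun i => (L.con ((p, i) : C) : N) := by
    have h1 : N ⊨ f (p, φ) := N.is_model.realize_of_mem _ (.inr ⟨(p, φ), hφ, rfl⟩)
    simp only [f] at h1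
    rw [Formula.realize_equivSentence, Formula.realize_relabel] at h1
    exact h1
  have hle (φ : L[[α]].Sentence) (hφ : φ ∈ p) :
      φ ∈ T.typeOf (M := N) fun i => (L.con ((p, i) : C) : N) := by
    rw [CompleteType.mem_typeOf]
    exact hreal _ (by simpa using hφ)
  refine SetLike.ext fun φ => ⟨fun h => ?_, hle φ⟩
  -- Inclusion between complete types is equality: a formula missing from `p` has its negation in
  -- `p`, hence in the larger type.
  by_contra hcon
  exact (CompleteType.not_mem_iff _ _).1 (hle _ ((p.not_mem_iff φ).2 hcon)) h

theorem typeOf_eq_of_equiv {T : L.Theory} {α : Type w₁} {N : Type*} [L.Structure N] [Nonempty N]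
    [N ⊨ T] (σ : N ≃[L] N) {a b : α → N} (h : ∀ i, σ (a i) = b i) : T.typeOf a = T.typeOf b := by
  refine SetLike.ext fun φ => ?_
  obtain rfl : σ ∘ a = b := funext h
  rw [CompleteType.mem_typeOf, CompleteType.mem_typeOf, StrongHomClass.realize_formula]

end FirstOrder.Language.Theory

/-! ### Counting types in bijective structures -/

namespace GenBij

variable {n : ℕ}

theorem realize_injSentence {M : Type*} [(unaryLanguage n).Structure M] (i : Fin n) :
    M ⊨ injSentence i ↔ Function.Injective fun x : M => Structure.funMap (symb i) ![x] := by
  have h (x : M) : ![x] = fun _ => x := by ext j; fin_cases j; rfl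
  simp [injSentence, Sentence.Realize, Formula.Realize, Function.Injective, Functions.apply₁,
    Fin.snoc, h]

theorem realize_surjSentence {M : Type*} [(unaryLanguage n).Structure M] (i : Fin n) :
    M ⊨ surjSentence i ↔ Function.Surjective fun x : M => Structure.funMap (symb i) ![x] := by
  have h (x : M) : ![x] = fun _ => x := by ext j; fin_cases j; rfl
  simp [surjSentence, Sentence.Realize, Formula.Realize, Function.Surjective, Functions.apply₁,
    Fin.snoc, h]

/-- In a bijective structure with added constants `A`, tuples with the same relations under the
free group generated by the basic functions have the same type. -/
theorem typeOf_eq_of_perm {A : Type*} {N : Type*} [(unaryLanguage n)[[A]].Structure N]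
    [Nonempty N] {T : (unaryLanguage n)[[A]].Theory} [N ⊨ T] (σ : Equiv.Perm N)
    (hσ : ∀ i x, σ (Structure.funMap (L := (unaryLanguage n)[[A]]) (Sum.inl (symb i)) ![x]) =
      Structure.funMap (L := (unaryLanguage n)[[A]]) (Sum.inl (symb i)) ![σ x])
    (hA : ∀ c : A, σ ((unaryLanguage n).con c : N) = ((unaryLanguage n).con c : N))
    {α : Type*} {a b : α → N} (hab : ∀ i, σ (a i) = b i) : T.typeOf a = T.typeOf b := by
  refine Theory.typeOf_eq_of_equiv (L := (unaryLanguage n)[[A]])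
    { σ with
      map_fun' := ?_
      map_rel' := ?_ } hab
  · intro m f x
    rcases f with f | f
    · obtain ⟨i⟩ := f
      obtain ⟨y, rfl⟩ : ∃ y, x = ![y] := ⟨x 0, by ext j; fin_cases j; rfl⟩
      have : (σ.toFun ∘ ![y]) = ![σ y] := by ext j; fin_cases j; rfl
      rw [this]
      exact hσ i y
    · cases m with
      | zero =>
        rw [Subsingleton.elim (σ.toFun ∘ x) default, Subsingleton.elim x default]
        exact hA f
      | succ m => exact isEmptyElim f
  · intro m r
    rcases r with r | r <;> exact isEmptyElim r

/-- The term `2 ^ ℵ₀` accounts for the subsets of the countable group; finite powers of an infinite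
cardinal add nothing. -/
theorem mk_prod_pow_le {G A : Type u} [Countable G] (k : ℕ) :
    #((Fin k → Option (G × A)) × (Fin k → Fin k → Set G)) ≤ #A + 2 ^ ℵ₀ := by
  have hc : ℵ₀ ≤ #A + 2 ^ ℵ₀ := (cantor ℵ₀).le.trans le_add_self
  have hG : #G ≤ ℵ₀ := mk_le_aleph0
  have hpow {c : Cardinal.{u}} (hc' : c ≤ #A + 2 ^ ℵ₀) (m : ℕ) : c ^ m ≤ #A + 2 ^ ℵ₀ :=
    (power_le_power_right hc').trans (power_nat_le hc)
  have h1 : #(Option (G × A)) ≤ #A + 2 ^ ℵ₀ := by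
    rw [mk_option, mk_prod, lift_id, lift_id]
    refine add_le_of_le hc ?_ (one_le_aleph0.trans hc)
    exact mul_le_of_le hc (hG.trans hc) le_self_add
  have h2 : #(Set G) ≤ #A + 2 ^ ℵ₀ := by
    rw [mk_set]
    exact (power_le_power_left two_ne_zero hG).trans le_add_self
  rw [mk_prod, lift_id, lift_id]
  refine mul_le_of_le hc ?_ ?_
  · simpa using hpow h1 k
  · simpa using hpow (hpow h2 k) k

/-- The bound on the number of types over a set in a structure whose functions are bijective. -/
theorem mk_typesOver_le (M : Type u) [(unaryLanguage n).Structure M] [Nonempty M]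
    (hinj : ∀ i : Fin n, M ⊨ injSentence i) (hsurj : ∀ i : Fin n, M ⊨ surjSentence i)
    (A : Set M) (k : ℕ) : #(TypesOver (unaryLanguage n) A k) ≤ #A + 2 ^ ℵ₀ := by
  set L' := (unaryLanguage n)[[A]]
  obtain ⟨N, hN⟩ := (completeTheory.isComplete L' M).exists_model_forall_realized (Fin k)
  let := ((unaryLanguage n).lhomWithConstants A).reduct N
  have : ((unaryLanguage n).lhomWithConstants A).IsExpansionOn N :=
    LHom.isExpansionOn_reduct _ _
  -- `N` satisfies the complete theory of `M`, so the functions are bijective on `N` too.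
  have transfer (φ : (unaryLanguage n).Sentence) (h : M ⊨ φ) : N ⊨ φ := by
    rw [← LHom.realize_onSentence N ((unaryLanguage n).lhomWithConstants A)]
    refine N.is_model.realize_of_mem _ ?_
    rw [mem_completeTheory, LHom.realize_onSentence]
    exact h
  let e (i : Fin n) : Equiv.Perm N := Equiv.ofBijective
    (fun x : N => Structure.funMap (symb i) ![x])
    ⟨(realize_injSentence i).1 (transfer _ (hinj i)),
      (realize_surjSentence i).1 (transfer _ (hsurj i))⟩
  let G := FreeGroup (ULift.{u} (Fin n))
  let : MulAction G N := MulAction.compHom N (FreeGroup.lift fun i : ULift.{u} (Fin n) => e i.down)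
  have hsmul (i : Fin n) (x : N) : (FreeGroup.of (ULift.up i) : G) • x =
      Structure.funMap (symb i) ![x] := by
    change (FreeGroup.lift fun i : ULift.{u} (Fin n) => e i.down) (FreeGroup.of (ULift.up i)) x = _
    rw [FreeGroup.lift_apply_of]
    rfl
  choose v hv using hN
  refine le_trans (mk_le_of_injective
    (f := fun p => MulAction.tupleRelations G (fun c : A => ((unaryLanguage n).con c : N)) (v p))
    fun p q hpq => ?_) (mk_prod_pow_le (G := G) (A := A) k)
  obtain ⟨σ, hσ, hσA, hσv⟩ := MulAction.exists_equivariant_perm_of_tupleRelations_eq _ hpq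
  rw [← hv p, ← hv q]
  refine typeOf_eq_of_perm σ (fun i x => ?_) hσA hσv
  have := hσ (FreeGroup.of (ULift.up i)) x
  rw [hsmul, hsmul] at this
  exact this

/-- The formula `x₀ = a` separates the types of the constant tuples; `1 ≤ k` supplies the variable
`x₀`. -/
theorem mk_le_mk_typesOver {L : FirstOrder.Language.{0, 0}} {M : Type u} [L.Structure M]
    [Nonempty M] (A : Set M) {k : ℕ} (hk : 1 ≤ k) : #A ≤ #(TypesOver L A k) := by
  refine mk_le_of_injective
    (f := fun a : A => (L[[A]].completeTheory M).typeOf (fun _ : Fin k => (a : M)))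
    fun a b hab => ?_
  let φ : L[[A]].Formula (Fin k) := Term.equal (Term.var ⟨0, hk⟩) (Constants.term (L.con a))
  have h1 : φ.Realize (fun _ : Fin k => (a : M)) := by simp [φ]
  rw [← Theory.CompleteType.formula_mem_typeOf (T := L[[A]].completeTheory M)] at h1
  dsimp only at hab
  rw [hab, Theory.CompleteType.formula_mem_typeOf] at h1
  simp [φ] at h1
  exact Subtype.ext h1.symm

end GenBij

theorem mainTheorem11 (n : ℕ)
    (V : GenBij.StructureClass.{w} (GenBij.unaryLanguage n))
    (hV : GenBij.IsGeneralizedBijective V)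
    (T : (GenBij.unaryLanguage n).Theory)
    (hT : GenBij.IsCompletion (GenBij.theoryOf V) T) :
    GenBij.IsSuperstable.{u} T ∧
    (∀ κ : Cardinal.{u}, 2 ^ Cardinal.aleph0.{u} ≤ κ → GenBij.IsStableIn T κ) ∧
    (∀ (M : Type u) [(GenBij.unaryLanguage n).Structure M] [Nonempty M] [M ⊨ T] (X : Set M),
      Cardinal.mk (GenBij.TypesOver (GenBij.unaryLanguage n) X 1) ≤
        Cardinal.mk X + 2 ^ Cardinal.aleph0.{u}) := by
  have bound (M : Type u) [(GenBij.unaryLanguage n).Structure M] [Nonempty M] [M ⊨ T] (X : Set M)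
      (k : ℕ) : #(GenBij.TypesOver (GenBij.unaryLanguage n) X k) ≤ #X + 2 ^ ℵ₀ := by
    have : M ⊨ GenBij.theoryOf V := ⟨fun φ hφ => (hT.2 φ hφ).realize_sentence M⟩
    exact GenBij.mk_typesOver_le M (fun i => (hV.injective i).realize_sentence M)
      (fun i => (hV.surjective i).realize_sentence M) X k
  have stable (κ : Cardinal.{u}) (hκ : 2 ^ ℵ₀ ≤ κ) : GenBij.IsStableIn T κ := by
    intro M _ _ _ A hA k hk
    refine le_antisymm ((bound M A k).trans ?_) (hA ▸ GenBij.mk_le_mk_typesOver A hk)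
    rw [hA, add_eq_left ((cantor ℵ₀).le.trans hκ) hκ]
  exact ⟨⟨2 ^ ℵ₀, fun κ _ hκ => stable κ hκ⟩, stable, fun M _ _ _ X => bound M X 1⟩
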